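/- For a commutative ring $A$ with identity, let $\mathrm{GL}(A)=\bigcup_{n}\mathrm{GL}_n(A)$, where $\mathrm{GL}_n(A)$ is embedded in $\mathrm{GL}_{n+1}(A)$ by $\alpha\mapsto\begin{pmatrix}\alpha&0\\0&1\end{pmatrix}$, and let $\mathrm{E}(A)=\bigcup_n \mathrm{E}_n(A)$, where $\mathrm{E}_n(A)$ is the subgroup of $\mathrm{GL}_n(A)$ generated by the elementary matrices $I+\lambda e_{ij}$ with $\lambda\in A$ and $i\neq j$. Then $\mathrm{E}(A)$ is normal in $\mathrm{GL}(A)$; put $\mathrm{K}_1(A)=\mathrm{GL}(A)/\mathrm{E}(A)$, and let $\mathrm{SK}_1(A)$ be the kernel of the homomorphism $\det:\mathrm{K}_1(A)\to A^{*}$ induced by the determinant. Corollary. Let $R$ be a commutative local ring with identity and let $k\in\mathbb{N}$ be such that $k$ (that is, $k\cdot 1_R$) is a unit in $R$. Then $\mathrm{SK}_1(R[X])$ has no $k$-torsion: if $x\in\mathrm{SK}_1(R[X])$ and $x^k=1$, then $x=1$. -/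

import Mathlib

namespace KOne

open Matrix

section Finite

variable {R : Type*} [CommRing R]

/-- `E_ι(R)`: the subgroup of `GL_ι(R)` generated by the elementary matrices `I + c e_{ij}`,
`i ≠ j`. -/
def elementary (ι : Type*) [Fintype ι] [DecidableEq ι] (R : Type*) [CommRing R] :
    Subgroup (GL ι R) :=
  Subgroup.closure
    {g | ∃ (i j : ι) (_ : i ≠ j) (c : R), (g : Matrix ι ι R) = Matrix.transvection i j c}

/-- The block sum `A ⊥ I_{j - i}` of size `j`, for a matrix `A` of size `i ≤ j`. -/
def perpOne {i j : ℕ} (_ : i ≤ j) (A : Matrix (Fin i) (Fin i) R) : Matrix (Fin j) (Fin j) R :=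
  Matrix.of fun a b =>
    if h : (a : ℕ) < i ∧ (b : ℕ) < i then A ⟨a, h.1⟩ ⟨b, h.2⟩ else if a = b then 1 else 0

theorem perpOne_eq_fromBlocks {i m : ℕ} (h : i ≤ i + m) (A : Matrix (Fin i) (Fin i) R) :
    perpOne h A = Matrix.reindex finSumFinEquiv finSumFinEquiv
      (Matrix.fromBlocks A 0 0 (1 : Matrix (Fin m) (Fin m) R)) := by
  ext a b
  obtain ⟨a, rfl⟩ := finSumFinEquiv.surjective a
  obtain ⟨b, rfl⟩ := finSumFinEquiv.surjective b
  rcases a with a | a <;> rcases b with b | b <;>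
    simp [perpOne, Matrix.one_apply, Fin.ext_iff]
  · intro h1
    have := a.isLt
    omega
  · intro h1
    have := b.isLt
    omega

theorem perpOne_one {i j : ℕ} (h : i ≤ j) : perpOne h (1 : Matrix (Fin i) (Fin i) R) = 1 := by
  obtain ⟨m, rfl⟩ := Nat.exists_eq_add_of_le h
  rw [perpOne_eq_fromBlocks, Matrix.fromBlocks_one]
  simp

theorem perpOne_mul {i j : ℕ} (h : i ≤ j) (A B : Matrix (Fin i) (Fin i) R) :
    perpOne h (A * B) = perpOne h A * perpOne h B := by
  obtain ⟨m, rfl⟩ := Nat.exists_eq_add_of_le h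
  simp only [perpOne_eq_fromBlocks, Matrix.reindex_apply, Matrix.submatrix_mul_equiv,
    Matrix.fromBlocks_multiply]
  simp

theorem det_perpOne {i j : ℕ} (h : i ≤ j) (A : Matrix (Fin i) (Fin i) R) :
    (perpOne h A).det = A.det := by
  obtain ⟨m, rfl⟩ := Nat.exists_eq_add_of_le h
  rw [perpOne_eq_fromBlocks, Matrix.det_reindex_self, Matrix.det_fromBlocks_zero₂₁]
  simp

theorem perpOne_self {i : ℕ} (A : Matrix (Fin i) (Fin i) R) : perpOne le_rfl A = A := by
  ext a b
  simp [perpOne]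

theorem perpOne_perpOne {i j k : ℕ} (h : i ≤ j) (h' : j ≤ k) (A : Matrix (Fin i) (Fin i) R) :
    perpOne h' (perpOne h A) = perpOne (h.trans h') A := by
  ext a b
  simp only [perpOne, Matrix.of_apply, Fin.ext_iff]
  split_ifs <;> first | rfl | omega

theorem perpOne_transvection {i j : ℕ} (h : i ≤ j) (a b : Fin i) (c : R) :
    perpOne h (Matrix.transvection a b c)
      = Matrix.transvection (Fin.castLE h a) (Fin.castLE h b) c := by
  ext x y
  simp only [perpOne, Matrix.transvection, Matrix.of_apply, Matrix.add_apply, Matrix.one_apply,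
    Matrix.single_apply, Fin.ext_iff, Fin.val_castLE]
  have := a.isLt
  have := b.isLt
  split_ifs <;> first | rfl | omega | simp

/-- The embedding `GL_i(R) → GL_j(R)`, `α ↦ α ⊥ I_{j - i}`, for `i ≤ j`. -/
def stabilize (R : Type*) [CommRing R] (i j : ℕ) (h : i ≤ j) : GL (Fin i) R →* GL (Fin j) R :=
  Units.map
    { toFun := perpOne h
      map_one' := perpOne_one h
      map_mul' := perpOne_mul h }

@[simp]
theorem coe_stabilize {i j : ℕ} (h : i ≤ j) (g : GL (Fin i) R) :
    (stabilize R i j h g : Matrix (Fin j) (Fin j) R) = perpOne h (g : Matrix (Fin i) (Fin i) R) :=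
  rfl

instance directedSystem (R : Type*) [CommRing R] :
    DirectedSystem (fun n => GL (Fin n) R) (fun i j h => stabilize R i j h) where
  map_self n g := Units.ext (perpOne_self (g : Matrix (Fin n) (Fin n) R))
  map_map _ _ i hij hjk g := Units.ext (perpOne_perpOne hij hjk (g : Matrix (Fin i) (Fin i) R))

theorem stabilize_mem_elementary {i j : ℕ} (h : i ≤ j) {g : GL (Fin i) R}
    (hg : g ∈ elementary (Fin i) R) : stabilize R i j h g ∈ elementary (Fin j) R := by
  have : elementary (Fin i) R ≤ (elementary (Fin j) R).comap (stabilize R i j h) := by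
    refine (Subgroup.closure_le _).2 ?_
    rintro g ⟨a, b, hab, c, hg⟩
    refine Subgroup.subset_closure ⟨Fin.castLE h a, Fin.castLE h b, ?_, c, ?_⟩
    · simpa using hab
    · rw [coe_stabilize, hg, perpOne_transvection]
  exact this hg

theorem det_eq_one_of_mem_elementary {ι : Type*} [Fintype ι] [DecidableEq ι] {g : GL ι R}
    (hg : g ∈ elementary ι R) : Matrix.GeneralLinearGroup.det g = 1 := by
  have : elementary ι R ≤ (Matrix.GeneralLinearGroup.det (n := ι) (R := R)).ker := by
    refine (Subgroup.closure_le _).2 ?_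
    rintro g ⟨a, b, hab, c, hg⟩
    refine Units.ext ?_
    rw [Matrix.GeneralLinearGroup.val_det_apply, hg, Matrix.det_transvection_of_ne a b hab]
    rfl
  exact this hg

end Finite

section Whitehead

variable {R : Type*} [CommRing R] {ι : Type*} [Fintype ι] [DecidableEq ι]

/-- The block matrix `(I X; 0 I)`. -/
def upperBlock (X : Matrix ι ι R) : GL (ι ⊕ ι) R where
  val := Matrix.fromBlocks 1 X 0 1
  inv := Matrix.fromBlocks 1 (-X) 0 1
  val_inv := by simp [Matrix.fromBlocks_multiply]
  inv_val := by simp [Matrix.fromBlocks_multiply]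

/-- The block matrix `(I 0; X I)`. -/
def lowerBlock (X : Matrix ι ι R) : GL (ι ⊕ ι) R where
  val := Matrix.fromBlocks 1 0 X 1
  inv := Matrix.fromBlocks 1 0 (-X) 1
  val_inv := by simp [Matrix.fromBlocks_multiply]
  inv_val := by simp [Matrix.fromBlocks_multiply]

/-- The block matrix `g ⊥ h`. -/
def diagBlock (g h : GL ι R) : GL (ι ⊕ ι) R where
  val := Matrix.fromBlocks g 0 0 h
  inv := Matrix.fromBlocks (g⁻¹ : GL ι R) 0 0 (h⁻¹ : GL ι R)
  val_inv := by
    rw [Matrix.fromBlocks_multiply]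
    simp only [← Units.val_mul]
    simp
  inv_val := by
    rw [Matrix.fromBlocks_multiply]
    simp only [← Units.val_mul]
    simp

theorem upperBlock_mem (X : Matrix ι ι R) : upperBlock X ∈ elementary (ι ⊕ ι) R := by
  induction X using Matrix.induction_on' with
  | h_zero =>
    have : upperBlock (0 : Matrix ι ι R) = 1 := by ext1; simp [upperBlock]
    rw [this]
    exact one_mem _
  | h_add p q hp hq =>
    have : upperBlock (p + q) = upperBlock p * upperBlock q := by
      apply Units.ext
      simp [upperBlock, Matrix.fromBlocks_multiply, add_comm]
    rw [this]
    exact mul_mem hp hq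
  | h_std_basis i j c =>
    refine Subgroup.subset_closure ⟨Sum.inl i, Sum.inr j, by simp, c, ?_⟩
    ext a b
    rcases a with a | a <;> rcases b with b | b <;>
      simp [upperBlock, Matrix.transvection, Matrix.single_apply, Matrix.one_apply]

theorem lowerBlock_mem (X : Matrix ι ι R) : lowerBlock X ∈ elementary (ι ⊕ ι) R := by
  induction X using Matrix.induction_on' with
  | h_zero =>
    have : lowerBlock (0 : Matrix ι ι R) = 1 := by ext1; simp [lowerBlock]
    rw [this]
    exact one_mem _
  | h_add p q hp hq =>
    have : lowerBlock (p + q) = lowerBlock p * lowerBlock q := by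
      apply Units.ext
      simp [lowerBlock, Matrix.fromBlocks_multiply]
    rw [this]
    exact mul_mem hp hq
  | h_std_basis i j c =>
    refine Subgroup.subset_closure ⟨Sum.inr i, Sum.inl j, by simp, c, ?_⟩
    ext a b
    rcases a with a | a <;> rcases b with b | b <;>
      simp [lowerBlock, Matrix.transvection, Matrix.single_apply, Matrix.one_apply]

/-- Whitehead's lemma: `g ⊥ g⁻¹` is a product of elementary matrices. -/
theorem diagBlock_inv_mem (g : GL ι R) : diagBlock g g⁻¹ ∈ elementary (ι ⊕ ι) R := by
  have : diagBlock g g⁻¹ =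
      upperBlock (g : Matrix ι ι R) * lowerBlock (-((g⁻¹ : GL ι R) : Matrix ι ι R))
        * upperBlock (g : Matrix ι ι R) * (upperBlock (-1) * lowerBlock 1 * upperBlock (-1)) := by
    apply Units.ext
    have h1 : (g : Matrix ι ι R) * ((g⁻¹ : GL ι R) : Matrix ι ι R) = 1 := g.mul_inv
    have h2 : ((g⁻¹ : GL ι R) : Matrix ι ι R) * (g : Matrix ι ι R) = 1 := g.inv_mul
    simp only [Units.val_mul, upperBlock, lowerBlock, diagBlock, Matrix.fromBlocks_multiply]
    simp only [Matrix.mul_neg, h1, Matrix.mul_one, Matrix.one_mul, Matrix.mul_zero]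
    simp
  rw [this]
  exact mul_mem (mul_mem (mul_mem (upperBlock_mem _) (lowerBlock_mem _)) (upperBlock_mem _))
    (mul_mem (mul_mem (upperBlock_mem _) (lowerBlock_mem _)) (upperBlock_mem _))

/-- The isomorphism `GL_{ι ⊕ ι}(R) ≅ GL_{2n}(R)` for `ι = {0, …, n - 1}`. -/
def reindexGL (n : ℕ) : GL (Fin n ⊕ Fin n) R →* GL (Fin (n + n)) R :=
  Units.map (Matrix.reindexRingEquiv R (finSumFinEquiv (m := n) (n := n)) :
    Matrix (Fin n ⊕ Fin n) (Fin n ⊕ Fin n) R →* Matrix (Fin (n + n)) (Fin (n + n)) R)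

theorem reindexGL_mem (n : ℕ) {g : GL (Fin n ⊕ Fin n) R}
    (hg : g ∈ elementary (Fin n ⊕ Fin n) R) : reindexGL n g ∈ elementary (Fin (n + n)) R := by
  have : elementary (Fin n ⊕ Fin n) R ≤ (elementary (Fin (n + n)) R).comap (reindexGL n) := by
    refine (Subgroup.closure_le _).2 ?_
    rintro g ⟨a, b, hab, c, hg⟩
    refine Subgroup.subset_closure
      ⟨finSumFinEquiv a, finSumFinEquiv b, finSumFinEquiv.injective.ne hab, c, ?_⟩
    change Matrix.reindex finSumFinEquiv finSumFinEquiv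
      (g : Matrix (Fin n ⊕ Fin n) (Fin n ⊕ Fin n) R) = _
    rw [hg]
    ext x y
    obtain ⟨x, rfl⟩ := finSumFinEquiv.surjective x
    obtain ⟨y, rfl⟩ := finSumFinEquiv.surjective y
    simp [Matrix.transvection, Matrix.single_apply, Matrix.one_apply]
  exact this hg

theorem reindexGL_diagBlock (n : ℕ) (g : GL (Fin n) R) :
    reindexGL n (diagBlock g 1) = stabilize R n (n + n) (Nat.le_add_right n n) g :=
  Units.ext (perpOne_eq_fromBlocks (Nat.le_add_right n n) (g : Matrix (Fin n) (Fin n) R)).symm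

/-- A conjugate of an elementary matrix becomes elementary in size `2n`. -/
theorem stabilize_conj_mem {n : ℕ} (g : GL (Fin n) R) {e : GL (Fin n) R}
    (he : e ∈ elementary (Fin n) R) :
    stabilize R n (n + n) (Nat.le_add_right n n) (g * e * g⁻¹) ∈ elementary (Fin (n + n)) R := by
  have key : diagBlock (g * e * g⁻¹) 1 = diagBlock g g⁻¹ * diagBlock e 1 * (diagBlock g g⁻¹)⁻¹ := by
    rw [eq_mul_inv_iff_mul_eq]
    apply Units.ext
    simp only [Units.val_mul, diagBlock, Matrix.fromBlocks_multiply]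
    simp [Matrix.mul_assoc, -Matrix.coe_units_inv]
  have hw := reindexGL_mem n (diagBlock_inv_mem g)
  rw [← reindexGL_diagBlock, key, map_mul, map_mul, map_inv, reindexGL_diagBlock]
  exact mul_mem (mul_mem hw (stabilize_mem_elementary _ he)) (inv_mem hw)

end Whitehead

section Stable

/-- The infinite general linear group `GL(R) = ⋃ₙ GL_n(R)`: the direct limit of the groups
`GL_n(R)` along the embeddings `α ↦ α ⊥ 1`. -/
abbrev StableGL (R : Type*) [CommRing R] : Type _ :=
  DirectLimit (fun n => GL (Fin n) R) (stabilize R)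

/-- The canonical map `GL_n(R) → GL(R)`. -/
noncomputable def toStable (R : Type*) [CommRing R] (n : ℕ) : GL (Fin n) R →* StableGL R where
  toFun g := ⟦⟨n, g⟩⟧
  map_one' := (DirectLimit.one_def n).symm
  map_mul' x y := (DirectLimit.mul_def (f := stabilize R) n x y).symm

/-- The infinite elementary group `E(R) = ⋃ₙ E_n(R)`. -/
noncomputable def stableElementary (R : Type*) [CommRing R] : Subgroup (StableGL R) :=
  ⨆ n : ℕ, (elementary (Fin n) R).map (toStable R n)

variable {R : Type*} [CommRing R]

@[simp]
theorem toStable_stabilize {i j : ℕ} (h : i ≤ j) (g : GL (Fin i) R) :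
    toStable R j (stabilize R i j h g) = toStable R i g :=
  DirectLimit.mk_apply (F := fun n => GL (Fin n) R) (f := stabilize R) i j g h

theorem mem_stableElementary_iff {x : StableGL R} :
    x ∈ stableElementary R ↔ ∃ n, ∃ e ∈ elementary (Fin n) R, toStable R n e = x := by
  unfold stableElementary
  rw [Subgroup.mem_iSup_of_directed]
  · rfl
  · refine Monotone.directed_le fun i j h => ?_
    rintro _ ⟨e, he, rfl⟩
    exact ⟨stabilize R i j h e, stabilize_mem_elementary h he, toStable_stabilize h e⟩

instance stableElementary_normal (R : Type*) [CommRing R] : (stableElementary R).Normal where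
  conj_mem x hx y := by
    obtain ⟨n, e, he, rfl⟩ := mem_stableElementary_iff.1 hx
    obtain ⟨m, g, rfl⟩ : ∃ m g, toStable R m g = y := by
      obtain ⟨m, g, h⟩ := DirectLimit.exists_eq_mk (stabilize R) y
      exact ⟨m, g, h.symm⟩
    rw [← toStable_stabilize (le_max_left n m) e, ← toStable_stabilize (le_max_right n m) g,
      ← map_mul, ← map_inv, ← map_mul, ← toStable_stabilize (Nat.le_add_right _ (max n m))]
    exact mem_stableElementary_iff.2
      ⟨_, _, stabilize_conj_mem _ (stabilize_mem_elementary _ he), rfl⟩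

/-- The Whitehead group `K₁(R) = GL(R) / E(R)`. -/
abbrev K1 (R : Type*) [CommRing R] : Type _ :=
  StableGL R ⧸ stableElementary R

/-- The determinant `GL(R) → Rˣ`. -/
noncomputable def stableDet (R : Type*) [CommRing R] : StableGL R →* Rˣ where
  toFun := DirectLimit.lift (stabilize R)
    (fun n => (Matrix.GeneralLinearGroup.det : GL (Fin n) R →* Rˣ))
    (fun i _ h g => Units.ext (det_perpOne h (g : Matrix (Fin i) (Fin i) R)).symm)
  map_one' := DirectLimit.lift_one _ _
  map_mul' := DirectLimit.lift_mul _ _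

/-- The determinant `K₁(R) → Rˣ`, `α E(R) ↦ det α`. -/
noncomputable def K1.det (R : Type*) [CommRing R] : K1 R →* Rˣ :=
  QuotientGroup.lift (stableElementary R) (stableDet R) fun x hx => by
    obtain ⟨n, e, he, rfl⟩ := mem_stableElementary_iff.1 hx
    exact det_eq_one_of_mem_elementary he

/-- `SK₁(R)`, the kernel of the determinant `K₁(R) → Rˣ`. -/
noncomputable def SK1 (R : Type*) [CommRing R] : Subgroup (K1 R) :=
  (K1.det R).ker

end Stable

end KOne

/-! Let `g` over `R[X]` have determinant 1 and k-torsion class. Since SK₁ of a local ring is trivial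
(`cls_eq_one_of_det_eq_one`), dividing by `g(0)` does not change the class. Higman's trick
(`exists_cls_eq_linear`) then replaces `g` by some `1 - XN` with `N` constant, and invertibility
over `R[X]` forces `N` to be nilpotent.

As `k` is a unit, `1 - X` is, modulo any power of `X`, the k-th power of a product of factors `1 -
r_m X^(m+1)` (`exists_prod_pow_sub_dvd`). Substituting `XN` for `X` writes `1 - XN` exactly as
`V^k`, where `V` is the product of the matrices `1 - r_m X^(m+1) N^(m+1)`.

The class of each factor is the image of `[1 - XN]` under a transfer: send `X` to the cyclic matrix
whose (m+1)-st power is `r_m X^(m+1)` (`cls_one_sub_pow_pow_eq_one`). Hence the class of each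
factor, and so of `V`, is killed by `k`, and `[1 - XN] = [V]^k = 1`. -/

namespace KOne

open Matrix

/-! ### Commutativity of K₁. -/

section Commutative

variable {A : Type*} [CommRing A]

theorem diagBlock_mul {ι : Type*} [Fintype ι] [DecidableEq ι] (a b c d : GL ι A) :
    diagBlock a b * diagBlock c d = diagBlock (a * c) (b * d) := by
  apply Units.ext
  simp [diagBlock, Matrix.fromBlocks_multiply]

/-- Three blocks `x ⊥ x⁻¹`, for `x = g`, `h`, `(hg)⁻¹`, multiply to the commutator in the first
block and to 1 in the second; Whitehead's lemma applies to each. -/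
theorem stabilize_commutator_mem {n : ℕ} (g h : GL (Fin n) A) :
    stabilize A n (n + n) (Nat.le_add_right n n) (g * h * (h * g)⁻¹) ∈
      elementary (Fin (n + n)) A := by
  have key : diagBlock (g * h * (h * g)⁻¹) 1 =
      diagBlock g g⁻¹ * diagBlock h h⁻¹ * diagBlock (h * g)⁻¹ (h * g)⁻¹⁻¹ := by
    rw [diagBlock_mul, diagBlock_mul]
    congr 1
    group
  rw [← reindexGL_diagBlock, key]
  exact reindexGL_mem n
    (mul_mem (mul_mem (diagBlock_inv_mem g) (diagBlock_inv_mem h)) (diagBlock_inv_mem (h * g)⁻¹))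

theorem exists_toStable_eq (x : StableGL A) : ∃ n, ∃ g : GL (Fin n) A, toStable A n g = x := by
  obtain ⟨m, g, h⟩ := DirectLimit.exists_eq_mk (stabilize A) x
  exact ⟨m, g, h.symm⟩

noncomputable instance (A : Type*) [CommRing A] : CommGroup (K1 A) where
  mul_comm x y := by
    obtain ⟨x, rfl⟩ := QuotientGroup.mk_surjective x
    obtain ⟨y, rfl⟩ := QuotientGroup.mk_surjective y
    obtain ⟨n, g, rfl⟩ := exists_toStable_eq x
    obtain ⟨m, h, rfl⟩ := exists_toStable_eq y
    rw [← toStable_stabilize (le_max_left n m) g, ← toStable_stabilize (le_max_right n m) h]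
    generalize stabilize A n (max n m) _ g = g
    generalize stabilize A m (max n m) _ h = h
    rw [← mul_inv_eq_one, ← QuotientGroup.mk_mul, ← QuotientGroup.mk_mul, ← QuotientGroup.mk_inv,
      ← QuotientGroup.mk_mul, QuotientGroup.eq_one_iff, ← map_mul, ← map_mul, ← map_inv, ← map_mul,
      ← toStable_stabilize (Nat.le_add_right _ (max n m))]
    exact mem_stableElementary_iff.2 ⟨_, _, stabilize_commutator_mem g h, rfl⟩

end Commutative

/-! ### Classes of matrices over arbitrary finite index sets. -/

section Class

variable {A : Type*} [CommRing A] {ι κ τ : Type*} [Fintype ι] [DecidableEq ι] [Fintype κ]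
  [DecidableEq κ] [Fintype τ] [DecidableEq τ]

/-- The isomorphism `GL_ι(A) ≅ GL_κ(A)` induced by a bijection of the index sets. -/
def relabel (e : ι ≃ κ) : GL ι A →* GL κ A :=
  Units.map (Matrix.reindexRingEquiv A e : Matrix ι ι A →* Matrix κ κ A)

@[simp]
theorem coe_relabel (e : ι ≃ κ) (g : GL ι A) :
    (relabel e g : Matrix κ κ A) = Matrix.reindex e e (g : Matrix ι ι A) := rfl

theorem relabel_trans (e : ι ≃ κ) (f : κ ≃ τ) (g : GL ι A) :
    relabel (e.trans f) g = relabel f (relabel e g) := by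
  ext a b
  simp

theorem relabel_mem (e : ι ≃ κ) {g : GL ι A} (hg : g ∈ elementary ι A) :
    relabel e g ∈ elementary κ A := by
  have : elementary ι A ≤ (elementary κ A).comap (relabel e) := by
    refine (Subgroup.closure_le _).2 ?_
    rintro g ⟨a, b, hab, c, hg⟩
    refine Subgroup.subset_closure ⟨e a, e b, e.injective.ne hab, c, ?_⟩
    rw [coe_relabel, hg]
    ext x y
    obtain ⟨x, rfl⟩ := e.surjective x
    obtain ⟨y, rfl⟩ := e.surjective y
    simp [Matrix.transvection, Matrix.single_apply, Matrix.one_apply]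
  exact this hg

/-- The class in `K₁(A)` of an invertible matrix with rows and columns indexed by `Fin n`. -/
noncomputable def finCls (A : Type*) [CommRing A] (n : ℕ) : GL (Fin n) A →* K1 A :=
  (QuotientGroup.mk' (stableElementary A)).comp (toStable A n)

theorem finCls_stabilize {i j : ℕ} (h : i ≤ j) (g : GL (Fin i) A) :
    finCls A j (stabilize A i j h g) = finCls A i g := by
  simp [finCls]

theorem finCls_eq_one_of_mem {n : ℕ} {g : GL (Fin n) A} (hg : g ∈ elementary (Fin n) A) :
    finCls A n g = 1 :=
  (QuotientGroup.eq_one_iff _).2 (mem_stableElementary_iff.2 ⟨n, g, hg, rfl⟩)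

theorem exists_stabilize_mem_of_finCls_eq_one {n : ℕ} {g : GL (Fin n) A} (hg : finCls A n g = 1) :
    ∃ (N : ℕ) (h : n ≤ N), stabilize A n N h g ∈ elementary (Fin N) A := by
  obtain ⟨m, e, he, h⟩ := mem_stableElementary_iff.1 ((QuotientGroup.eq_one_iff _).1 hg)
  obtain ⟨N, h1, h2, h3⟩ := Quotient.exact h
  refine ⟨N, h2, ?_⟩
  have h3 : stabilize A m N h1 e = stabilize A n N h2 g := h3
  rw [← h3]
  exact stabilize_mem_elementary h1 he

/-- Relabelling is conjugation by a permutation matrix, which is invisible in a commutative group.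
This makes `cls` independent of the enumeration of the index set. -/
theorem finCls_relabel_perm {n : ℕ} (σ : Equiv.Perm (Fin n)) (g : GL (Fin n) A) :
    finCls A n (relabel σ g) = finCls A n g := by
  let p : GL (Fin n) A :=
    { val := (σ⁻¹).permMatrix A
      inv := σ.permMatrix A
      val_inv := by rw [← Matrix.permMatrix_mul]; simp
      inv_val := by rw [← Matrix.permMatrix_mul]; simp }
  have : relabel σ g * p = p * g := by
    apply Units.ext
    ext a b
    simp [p, PEquiv.toMatrix_toPEquiv_mul, PEquiv.mul_toMatrix_toPEquiv, ← Equiv.Perm.inv_def]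
    simp
  have h := congrArg (finCls A n) this
  rw [map_mul, map_mul, mul_comm] at h
  exact mul_left_cancel h

/-- The class in `K₁(A)` of an invertible matrix with entries in `A`. -/
noncomputable def cls : GL ι A →* K1 A :=
  (finCls A (Fintype.card ι)).comp (relabel (Fintype.equivFin ι))

theorem finCls_relabel {n : ℕ} (e : ι ≃ Fin n) (g : GL ι A) :
    finCls A n (relabel e g) = cls g := by
  obtain rfl : Fintype.card ι = n := by simpa using Fintype.card_congr e
  have : relabel e g =
      relabel ((Fintype.equivFin ι).symm.trans e) (relabel (Fintype.equivFin ι) g) := by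
    rw [← relabel_trans, ← Equiv.trans_assoc, Equiv.self_trans_symm, Equiv.refl_trans]
  rw [this, finCls_relabel_perm]
  rfl

theorem cls_eq_finCls {n : ℕ} (g : GL (Fin n) A) : cls g = finCls A n g := by
  rw [← finCls_relabel (Equiv.refl (Fin n))]
  rfl

theorem cls_relabel (e : ι ≃ κ) (g : GL ι A) : cls (relabel e g) = cls g := by
  rw [← finCls_relabel (e.trans (Fintype.equivFin κ)), relabel_trans, finCls_relabel]

theorem cls_eq_one_of_mem {g : GL ι A} (hg : g ∈ elementary ι A) : cls g = 1 :=
  finCls_eq_one_of_mem (relabel_mem _ hg)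

theorem det_finCls {n : ℕ} (g : GL (Fin n) A) :
    K1.det A (finCls A n g) = Matrix.GeneralLinearGroup.det g := rfl

theorem det_cls (g : GL ι A) : K1.det A (cls g) = Matrix.GeneralLinearGroup.det g := by
  rw [← finCls_relabel (Fintype.equivFin ι), det_finCls]
  ext
  simp [Matrix.det_reindex_self, -Matrix.reindex_apply]

/-- The embedding `GL_ι(A) → GL_{ι ⊕ κ}(A)`, `g ↦ g ⊥ 1`. -/
def inlGL (κ : Type*) [Fintype κ] [DecidableEq κ] : GL ι A →* GL (ι ⊕ κ) A :=
  Units.map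
    { toFun := fun M => Matrix.fromBlocks M 0 0 1
      map_one' := Matrix.fromBlocks_one
      map_mul' := fun M N => by simp [Matrix.fromBlocks_multiply] }

/-- The embedding `GL_κ(A) → GL_{ι ⊕ κ}(A)`, `g ↦ 1 ⊥ g`. -/
def inrGL (ι : Type*) [Fintype ι] [DecidableEq ι] : GL κ A →* GL (ι ⊕ κ) A :=
  Units.map
    { toFun := fun M => Matrix.fromBlocks 1 0 0 M
      map_one' := Matrix.fromBlocks_one
      map_mul' := fun M N => by simp [Matrix.fromBlocks_multiply] }

@[simp]
theorem coe_inlGL (g : GL ι A) :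
    (inlGL κ g : Matrix (ι ⊕ κ) (ι ⊕ κ) A) = Matrix.fromBlocks (g : Matrix ι ι A) 0 0 1 := rfl

@[simp]
theorem coe_inrGL (g : GL κ A) :
    (inrGL ι g : Matrix (ι ⊕ κ) (ι ⊕ κ) A) = Matrix.fromBlocks 1 0 0 (g : Matrix κ κ A) := rfl

theorem cls_inlGL (g : GL ι A) : cls (inlGL κ g) = cls g := by
  rw [← finCls_relabel (Fintype.equivFin ι),
    ← finCls_relabel (((Fintype.equivFin ι).sumCongr (Fintype.equivFin κ)).trans finSumFinEquiv),
    ← finCls_stabilize (Nat.le_add_right (Fintype.card ι) (Fintype.card κ))]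
  congr 1
  rw [relabel_trans]
  apply Units.ext
  rw [coe_stabilize, perpOne_eq_fromBlocks, coe_relabel]
  congr 1
  ext a b
  rcases a with a | a <;> rcases b with b | b <;> simp [Matrix.one_apply]

theorem cls_inrGL (g : GL κ A) : cls (inrGL ι g) = cls g := by
  rw [← cls_inlGL (κ := ι) g, ← cls_relabel (Equiv.sumComm κ ι)]
  congr 1
  apply Units.ext
  ext a b
  rcases a with a | a <;> rcases b with b | b <;> simp [Matrix.one_apply]

/-- The block matrix `(I X; 0 I)`. -/
def upperGL (X : Matrix ι κ A) : GL (ι ⊕ κ) A where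
  val := Matrix.fromBlocks 1 X 0 1
  inv := Matrix.fromBlocks 1 (-X) 0 1
  val_inv := by simp [Matrix.fromBlocks_multiply]
  inv_val := by simp [Matrix.fromBlocks_multiply]

/-- The block matrix `(I 0; X I)`. -/
def lowerGL (X : Matrix κ ι A) : GL (ι ⊕ κ) A where
  val := Matrix.fromBlocks 1 0 X 1
  inv := Matrix.fromBlocks 1 0 (-X) 1
  val_inv := by simp [Matrix.fromBlocks_multiply]
  inv_val := by simp [Matrix.fromBlocks_multiply]

@[simp]
theorem coe_upperGL (X : Matrix ι κ A) :
    (upperGL X : Matrix (ι ⊕ κ) (ι ⊕ κ) A) = Matrix.fromBlocks 1 X 0 1 := rfl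

@[simp]
theorem coe_lowerGL (X : Matrix κ ι A) :
    (lowerGL X : Matrix (ι ⊕ κ) (ι ⊕ κ) A) = Matrix.fromBlocks 1 0 X 1 := rfl

theorem upperGL_mem (X : Matrix ι κ A) : upperGL X ∈ elementary (ι ⊕ κ) A := by
  induction X using Matrix.induction_on' with
  | h_zero =>
    have : upperGL (0 : Matrix ι κ A) = 1 := by ext1; simp
    rw [this]
    exact one_mem _
  | h_add p q hp hq =>
    have : upperGL (p + q) = upperGL p * upperGL q := by
      apply Units.ext
      simp [Matrix.fromBlocks_multiply, add_comm]
    rw [this]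
    exact mul_mem hp hq
  | h_std_basis i j c =>
    refine Subgroup.subset_closure ⟨Sum.inl i, Sum.inr j, by simp, c, ?_⟩
    ext a b
    rcases a with a | a <;> rcases b with b | b <;>
      simp [Matrix.transvection, Matrix.single_apply, Matrix.one_apply]

@[simp]
theorem cls_upperGL (X : Matrix ι κ A) : cls (upperGL X) = 1 :=
  cls_eq_one_of_mem (upperGL_mem X)

@[simp]
theorem cls_lowerGL (X : Matrix κ ι A) : cls (lowerGL X) = 1 := by
  rw [← cls_upperGL X, ← cls_relabel (Equiv.sumComm κ ι)]
  congr 1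
  apply Units.ext
  ext a b
  rcases a with a | a <;> rcases b with b | b <;> simp [Matrix.one_apply]

/-- Both sides of the identity in the proof equal the block matrix `(1 X; Y 1)`. Nearly all later
comparisons of classes reduce to this exchange of `XY` and `YX`. -/
theorem cls_eq_of_one_sub_mul {X : Matrix ι κ A} {Y : Matrix κ ι A} {u : GL ι A} {v : GL κ A}
    (hu : (u : Matrix ι ι A) = 1 - X * Y) (hv : (v : Matrix κ κ A) = 1 - Y * X) :
    cls u = cls v := by
  have : upperGL X * inlGL κ u * lowerGL Y = lowerGL Y * inrGL ι v * upperGL X := by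
    apply Units.ext
    simp [Matrix.fromBlocks_multiply, hu, hv]
  simpa [cls_inlGL, cls_inrGL] using congrArg cls this

end Class

/-! ### Transfer along a homomorphism into a matrix ring. -/

section Transfer

variable {A B : Type*} [CommRing A] [CommRing B] {p : Type*} [Fintype p] [DecidableEq p]
  {ι κ : Type*} [Fintype ι] [DecidableEq ι] [Fintype κ] [DecidableEq κ]

/-- The homomorphism `GL_ι(A) → GL_{ι × p}(B)` induced by a ring homomorphism `A → M_p(B)`. -/
def transfer (ρ : A →+* Matrix p p B) : GL ι A →* GL (ι × p) B :=
  Units.map (((Matrix.compRingEquiv ι p B : Matrix ι ι (Matrix p p B) →+* _).comp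
    ρ.mapMatrix : Matrix ι ι A →+* Matrix (ι × p) (ι × p) B) : _ →* _)

@[simp]
theorem coe_transfer_apply (ρ : A →+* Matrix p p B) (g : GL ι A) (a b : ι × p) :
    (transfer ρ g : Matrix (ι × p) (ι × p) B) a b = ρ (g a.1 b.1) a.2 b.2 := rfl

theorem cls_eq_one_of_mul_eq_zero {X : Matrix ι κ A} {Y : Matrix κ ι A} {u : GL ι A}
    (hu : (u : Matrix ι ι A) = 1 - X * Y) (h : Y * X = 0) : cls u = 1 := by
  rw [cls_eq_of_one_sub_mul (v := 1) hu (by simp [h]), map_one]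

/-- The image is `1 - XY` with `X` equal to `-ρ c` in block row `i` and `Y` the identity in block
column `j`; `i ≠ j` gives `YX = 0`. -/
theorem cls_transfer_transvection (ρ : A →+* Matrix p p B) {i j : ι} (hij : i ≠ j) (c : A)
    {g : GL ι A} (hg : (g : Matrix ι ι A) = Matrix.transvection i j c) :
    cls (transfer ρ g) = 1 := by
  refine cls_eq_one_of_mul_eq_zero (κ := p)
    (X := Matrix.of fun a b => if a.1 = i then -ρ c a.2 b else 0)
    (Y := Matrix.of fun a b => if b.1 = j then if a = b.2 then 1 else 0 else 0) ?_ ?_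
  · ext ⟨a, b⟩ ⟨a', b'⟩
    rw [coe_transfer_apply, hg]
    have h1 : ρ (Matrix.transvection i j c a a') =
        (if a = a' then 1 else 0) + if i = a ∧ j = a' then ρ c else 0 := by
      simp only [Matrix.transvection, Matrix.add_apply, Matrix.one_apply, Matrix.single_apply,
        map_add, apply_ite ρ, map_one, map_zero]
    rw [h1, Matrix.add_apply, Matrix.sub_apply, Matrix.one_apply, sub_eq_add_neg]
    congr 1
    · by_cases h : a = a' <;> simp [h, Matrix.one_apply]
    · by_cases h : a = i <;> by_cases h' : a' = j <;>
        simp [Matrix.mul_apply, h, h', @eq_comm _ i a, @eq_comm _ j a']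
  · ext a b
    rw [Matrix.mul_apply, Fintype.sum_prod_type]
    refine Finset.sum_eq_zero fun x _ => Finset.sum_eq_zero fun y _ => ?_
    by_cases h : x = i
    · simp [h, hij]
    · simp [h]

theorem cls_transfer_of_mem (ρ : A →+* Matrix p p B) {g : GL ι A} (hg : g ∈ elementary ι A) :
    cls (transfer ρ g) = 1 := by
  have : elementary ι A ≤ (cls.comp (transfer (ι := ι) ρ)).ker := by
    refine (Subgroup.closure_le _).2 ?_
    rintro g ⟨a, b, hab, c, hg⟩
    exact cls_transfer_transvection ρ hab c hg
  exact this hg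

theorem cls_transfer_relabel (ρ : A →+* Matrix p p B) (e : ι ≃ κ) (g : GL ι A) :
    cls (transfer ρ (relabel e g)) = cls (transfer ρ g) := by
  rw [← cls_relabel (e.prodCongr (Equiv.refl p)) (transfer ρ g)]
  congr 1

theorem cls_transfer_inlGL (ρ : A →+* Matrix p p B) (g : GL ι A) :
    cls (transfer ρ (inlGL κ g)) = cls (transfer ρ g) := by
  rw [← cls_inlGL (κ := κ × p) (transfer ρ g), ← cls_relabel (Equiv.sumProdDistrib ι κ p).symm]
  congr 1
  apply Units.ext
  ext ⟨a, b⟩ ⟨a', b'⟩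
  rcases a with a | a <;> rcases a' with a' | a'
  · simp
  · simp
  · simp
  · by_cases h : a = a' <;> simp [Matrix.one_apply, h]

theorem stabilize_eq_relabel {n m : ℕ} (h : n ≤ n + m) (g : GL (Fin n) A) :
    stabilize A n (n + m) h g = relabel finSumFinEquiv (inlGL (Fin m) g) :=
  Units.ext (perpOne_eq_fromBlocks h (g : Matrix (Fin n) (Fin n) A))

/-- The transfer along a ring homomorphism `A → M_p(B)` is well defined on `K₁`. -/
theorem cls_transfer_eq_one (ρ : A →+* Matrix p p B) {g : GL ι A} (hg : cls g = 1) :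
    cls (transfer ρ g) = 1 := by
  obtain ⟨N, h, hN⟩ :=
    exists_stabilize_mem_of_finCls_eq_one (g := relabel (Fintype.equivFin ι) g) hg
  obtain ⟨m, rfl⟩ := Nat.exists_eq_add_of_le h
  have := cls_transfer_of_mem ρ hN
  rwa [stabilize_eq_relabel, cls_transfer_relabel, cls_transfer_inlGL, cls_transfer_relabel] at this

theorem cls_map_eq_one (f : A →+* B) {g : GL ι A} (hg : cls g = 1) :
    cls (Matrix.GeneralLinearGroup.map f g) = 1 := by
  -- Functoriality is the transfer into 1 × 1 matrices.
  have := cls_transfer_eq_one ((Matrix.scalar Unit).comp f) hg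
  rw [← cls_relabel (Equiv.prodPUnit ι).symm, ← this]
  congr 1

end Transfer
open Polynomial

open scoped Kronecker

/-! ### Triviality of SK₁ for local rings. -/

section Local

variable {R : Type*} [CommRing R] {ι : Type*} [Fintype ι] [DecidableEq ι]

theorem exists_cls_eq_mul_of_isUnit {g : GL (ι ⊕ Unit) R}
    (hg : IsUnit ((g : Matrix (ι ⊕ Unit) (ι ⊕ Unit) R) (Sum.inr ()) (Sum.inr ()))) :
    ∃ (h : GL ι R) (u : GL Unit R), cls g = cls h * cls u := by
  obtain ⟨d, hd⟩ := hg
  let G := (g : Matrix (ι ⊕ Unit) (ι ⊕ Unit) R)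
  let D : GL Unit R := Units.map (Matrix.scalar Unit : R →+* Matrix Unit Unit R).toMonoidHom d
  let D' : Matrix Unit Unit R := ((D⁻¹ : GL Unit R) : Matrix Unit Unit R)
  have hD : (D : Matrix Unit Unit R) = G.toBlocks₂₂ := by
    ext ⟨⟩ ⟨⟩
    simp [D, G, hd, Matrix.toBlocks₂₂]
  have h1 : (D : Matrix Unit Unit R) * D' = 1 := D.mul_inv
  have h2 : D' * (D : Matrix Unit Unit R) = 1 := D.inv_mul
  -- The Schur complement of the unit corner, left over after clearing the last row and column.
  let S := G.toBlocks₁₁ - G.toBlocks₁₂ * D' * G.toBlocks₂₁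
  have key : ((upperGL (-(G.toBlocks₁₂ * D')) * g * lowerGL (-(D' * G.toBlocks₂₁)) :
      GL (ι ⊕ Unit) R) : Matrix (ι ⊕ Unit) (ι ⊕ Unit) R) =
      Matrix.fromBlocks S 0 0 (D : Matrix Unit Unit R) := by
    have h0 : (g : Matrix (ι ⊕ Unit) (ι ⊕ Unit) R) =
      Matrix.fromBlocks G.toBlocks₁₁ G.toBlocks₁₂ G.toBlocks₂₁ D := by
      rw [hD, Matrix.fromBlocks_toBlocks]
    have h3 : G.toBlocks₁₂ * D' * (D : Matrix Unit Unit R) = G.toBlocks₁₂ := by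
      rw [Matrix.mul_assoc, h2, Matrix.mul_one]
    have h4 : (D : Matrix Unit Unit R) * (D' * G.toBlocks₂₁) = G.toBlocks₂₁ := by
      rw [← Matrix.mul_assoc, h1, Matrix.one_mul]
    rw [Units.val_mul, Units.val_mul, h0]
    simp only [coe_upperGL, coe_lowerGL, Matrix.fromBlocks_multiply, Matrix.neg_mul,
      Matrix.mul_neg, Matrix.mul_one, Matrix.one_mul, Matrix.zero_mul, Matrix.mul_zero, h3, h4,
      add_neg_cancel, zero_add, add_zero, neg_zero, S, sub_eq_add_neg]
  have hS : IsUnit S := by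
    rw [Matrix.isUnit_iff_isUnit_det]
    have := congrArg Matrix.det key
    rw [Matrix.det_fromBlocks_zero₂₁] at this
    refine isUnit_of_mul_isUnit_left (y := (D : Matrix Unit Unit R).det) ?_
    rw [← this]
    exact (Matrix.isUnit_iff_isUnit_det _).1 (Units.isUnit _)
  obtain ⟨s, hs⟩ := hS
  refine ⟨s, D, ?_⟩
  have : upperGL (-(G.toBlocks₁₂ * D')) * g * lowerGL (-(D' * G.toBlocks₂₁)) =
      inlGL Unit s * inrGL ι D := by
    apply Units.ext
    rw [key]
    simp [Matrix.fromBlocks_multiply, hs]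
  simpa [cls_inlGL, cls_inrGL] using congrArg cls this

/-- A column inside the maximal ideal would put a diagonal entry of `g⁻¹ g`, namely 1, into that
ideal. -/
theorem exists_isUnit_apply [IsLocalRing R] (g : GL ι R) (j : ι) :
    ∃ i, IsUnit ((g : Matrix ι ι R) i j) := by
  by_contra! h
  have h1 : (((g⁻¹ : GL ι R) : Matrix ι ι R) * (g : Matrix ι ι R)) j j = 1 := by
    rw [← Units.val_mul, inv_mul_cancel]
    simp
  have h2 : (1 : R) ∈ IsLocalRing.maximalIdeal R := by
    rw [← h1, Matrix.mul_apply]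
    exact Ideal.sum_mem _ fun i _ => Ideal.mul_mem_left _ _ (h i)
  exact h2 isUnit_one

theorem exists_cls_eq_mul [IsLocalRing R] (g : GL (ι ⊕ Unit) R) :
    ∃ (h : GL ι R) (u : GL Unit R), cls g = cls h * cls u := by
  by_cases hg : IsUnit ((g : Matrix (ι ⊕ Unit) (ι ⊕ Unit) R) (Sum.inr ()) (Sum.inr ()))
  · exact exists_cls_eq_mul_of_isUnit hg
  obtain ⟨i | ⟨⟩, hi⟩ := exists_isUnit_apply g (Sum.inr ())
  -- Adding row `i` to the last row makes the corner a unit plus a nonunit, hence a unit.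
  · let L : GL (ι ⊕ Unit) R := lowerGL (Matrix.of fun _ a => if a = i then 1 else 0)
    have : cls g = cls (L * g) := by simp [L]
    rw [this]
    refine exists_cls_eq_mul_of_isUnit ?_
    have : ((L * g : GL (ι ⊕ Unit) R) : Matrix (ι ⊕ Unit) (ι ⊕ Unit) R) (Sum.inr ()) (Sum.inr ()) =
        (g : Matrix (ι ⊕ Unit) (ι ⊕ Unit) R) (Sum.inl i) (Sum.inr ()) +
          (g : Matrix (ι ⊕ Unit) (ι ⊕ Unit) R) (Sum.inr ()) (Sum.inr ()) := by
      simp [L, Matrix.mul_apply]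
    rw [this]
    by_contra hn
    exact (IsLocalRing.nonunits_add hn (show -_ ∈ nonunits R from fun h => hg (by simpa using h)))
      (by simpa using hi)
  · exact absurd hi hg

theorem exists_cls_eq_cls_unit [IsLocalRing R] {n : ℕ} (g : GL (Fin n) R) :
    ∃ u : GL Unit R, cls g = cls u := by
  induction n with
  | zero => exact ⟨1, by rw [Subsingleton.elim g 1, map_one, map_one]⟩
  | succ n ih =>
    let e : Fin (n + 1) ≃ Fin n ⊕ Unit := (finSumFinEquiv (m := n) (n := 1)).symm.trans
      ((Equiv.refl (Fin n)).sumCongr (Equiv.equivPUnit (Fin 1)))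
    obtain ⟨h, u, hu⟩ := exists_cls_eq_mul (relabel e g)
    obtain ⟨u', hu'⟩ := ih h
    exact ⟨u' * u, by rw [← cls_relabel e, hu, hu', map_mul]⟩

/-- `SK₁` of a local ring is trivial. -/
theorem cls_eq_one_of_det_eq_one [IsLocalRing R] {n : ℕ} {g : GL (Fin n) R}
    (hg : Matrix.GeneralLinearGroup.det g = 1) : cls g = 1 := by
  obtain ⟨u, hu⟩ := exists_cls_eq_cls_unit g
  have h := congrArg (K1.det R) hu
  rw [det_cls, det_cls, hg] at h
  have : u = 1 := by
    apply Units.ext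
    ext ⟨⟩ ⟨⟩
    simpa using (congrArg Units.val h).symm
  rw [hu, this, map_one]

end Local

/-! ### Reduction to `1 - XN` with `N` nilpotent. -/

section Linearization

variable {R : Type*} [CommRing R]

/-- Higman's linearization trick. -/
theorem exists_cls_eq_linear (d : ℕ) {ι : Type} [Fintype ι] [DecidableEq ι] (g : GL ι R[X])
    (hd : ∀ a b, ((g : Matrix ι ι R[X]) a b).natDegree ≤ d + 1)
    (h0 : ∀ a b, ((g : Matrix ι ι R[X]) a b).coeff 0 = (1 : Matrix ι ι R) a b) :
    ∃ (κ : Type) (_ : Fintype κ) (_ : DecidableEq κ) (N : Matrix κ κ R) (u : GL κ R[X]),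
      (u : Matrix κ κ R[X]) = 1 - (X : R[X]) • N.map C ∧ cls u = cls g := by
  induction d generalizing ι with
  | zero =>
    refine ⟨ι, inferInstance, inferInstance,
      Matrix.of fun a b => -((g : Matrix ι ι R[X]) a b).coeff 1, g, ?_, rfl⟩
    ext1 a b
    rw [Polynomial.eq_X_add_C_of_natDegree_le_one (hd a b), h0]
    by_cases h : a = b <;> simp [Matrix.one_apply, h]
    ring
  | succ d ih =>
    -- `X T` is the part of degree `d + 2`. One row and one column operation on `g ⊥ 1` remove it,
    -- at the cost of doubling the size and creating blocks of degree at most `d + 1`.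
    let T : Matrix ι ι R[X] :=
      Matrix.of fun a b => C (((g : Matrix ι ι R[X]) a b).coeff (d + 2)) * X ^ (d + 1)
    let g' : GL (ι ⊕ ι) R[X] := upperGL T * inlGL ι g * lowerGL (-(X : R[X]) • 1)
    have hg' : (g' : Matrix (ι ⊕ ι) (ι ⊕ ι) R[X]) =
        Matrix.fromBlocks ((g : Matrix ι ι R[X]) - (X : R[X]) • T) T (-(X : R[X]) • 1) 1 := by
      simp [g', Matrix.fromBlocks_multiply, sub_eq_add_neg]
    have hT : ∀ a b, ((X : R[X]) • T) a b =
        C (((g : Matrix ι ι R[X]) a b).coeff (d + 2)) * X ^ (d + 2) := fun a b => by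
      simp only [Matrix.smul_apply, T, Matrix.of_apply, smul_eq_mul]
      ring
    have hd' : ∀ a b, ((g' : Matrix (ι ⊕ ι) (ι ⊕ ι) R[X]) a b).natDegree ≤ d + 1 := by
      rw [hg']
      rintro (a | a) (b | b)
      · rw [Matrix.fromBlocks_apply₁₁, Matrix.sub_apply, hT,
          Polynomial.natDegree_le_iff_coeff_eq_zero]
        intro i hi
        rcases (show d + 2 ≤ i from hi).eq_or_lt with rfl | hi
        · simp
        · rw [coeff_sub, coeff_C_mul_X_pow, if_neg hi.ne', sub_zero]
          exact coeff_eq_zero_of_natDegree_lt ((hd a b).trans_lt hi)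
      · simp only [Matrix.fromBlocks_apply₁₂, T, Matrix.of_apply]
        exact natDegree_C_mul_X_pow_le _ _
      · by_cases h : a = b <;> simp [h, natDegree_X_le.trans]
      · by_cases h : a = b <;> simp [h]
    have h0' : ∀ a b, ((g' : Matrix (ι ⊕ ι) (ι ⊕ ι) R[X]) a b).coeff 0 =
        (1 : Matrix (ι ⊕ ι) (ι ⊕ ι) R) a b := by
      rw [hg']
      rintro (a | a) (b | b)
      · rw [Matrix.fromBlocks_apply₁₁, Matrix.sub_apply, hT, coeff_sub, h0, coeff_C_mul_X_pow]
        simp [Matrix.one_apply]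
      · simp [T, coeff_X_pow]
      · by_cases h : a = b <;> simp [h]
      · by_cases h : a = b <;> simp [h, Matrix.one_apply]
    obtain ⟨κ, h1, h2, N, u, hu, hu'⟩ := ih g' hd' h0'
    refine ⟨κ, h1, h2, N, u, hu, ?_⟩
    rw [hu']
    simp [g', cls_inlGL]

/-- Viewed as a polynomial with matrix coefficients, the inverse must be the geometric series with
coefficients `N ^ i`; being a polynomial, it stops. -/
theorem isNilpotent_of_isUnit_one_sub_X_smul {κ : Type*} [Fintype κ] [DecidableEq κ]
    {N : Matrix κ κ R} (h : IsUnit (1 - (X : R[X]) • N.map C)) : IsNilpotent N := by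
  obtain ⟨V, hV⟩ := h.exists_left_inv
  have h1 := congrArg matPolyEquiv hV
  have h2 : matPolyEquiv (1 - (X : R[X]) • N.map C) = 1 - C N * X := by
    rw [map_sub, map_one, Matrix.smul_eq_diagonal_mul, map_mul]
    simp [matPolyEquiv_map_C]
  rw [map_mul, map_one, h2] at h1
  set p := matPolyEquiv V
  have h3 : ∀ i, p.coeff i = N ^ i := by
    intro i
    induction i with
    | zero =>
      have := congrArg (fun q => coeff q 0) h1
      simpa [mul_sub, ← mul_assoc] using this
    | succ i ih =>
      have := congrArg (fun q => coeff q (i + 1)) h1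
      simp only [mul_sub, ← mul_assoc, mul_one, coeff_sub, coeff_mul_X, coeff_mul_C, ih] at this
      rw [pow_succ, ← sub_eq_zero, this, coeff_one, if_neg (by omega)]
  exact ⟨p.natDegree + 1, by rw [← h3]; exact coeff_eq_zero_of_natDegree_lt (Nat.lt_succ_self _)⟩

end Linearization

/-! ### An approximate k-th root of `1 - X`. -/

section Root

variable {R : Type*} [CommRing R]

theorem exists_prod_pow_sub_dvd {k : ℕ} (hk : IsUnit (k : R)) (M : ℕ) :
    ∃ r : ℕ → R, (X : R[X]) ^ (M + 1) ∣
      (∏ m ∈ Finset.range M, (1 - C (r m) * X ^ (m + 1))) ^ k - (1 - X) := by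
  induction M with
  | zero => exact ⟨0, by simp⟩
  | succ M ih =>
    obtain ⟨r, q, hq⟩ := ih
    obtain ⟨v, hv⟩ := hk.exists_right_inv
    -- The new factor to the power `k` is `1 - k c X^(M+1)` up to higher order, so `k c` must equal
    -- the leading error `q.coeff 0`.
    let c := v * q.coeff 0
    refine ⟨Function.update r M c, ?_⟩
    have h1 : ∏ m ∈ Finset.range M, (1 - C (Function.update r M c m) * (X : R[X]) ^ (m + 1)) =
        ∏ m ∈ Finset.range M, (1 - C (r m) * (X : R[X]) ^ (m + 1)) :=
      Finset.prod_congr rfl fun m hm => by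
        rw [Function.update_of_ne (Finset.mem_range.1 hm).ne]
    rw [Finset.prod_range_succ, h1, Function.update_self, mul_pow]
    obtain ⟨s, hs⟩ := Polynomial.powAddExpansion (1 : R[X]) (-(C c * X ^ (M + 1))) k
    rw [← sub_eq_add_neg] at hs
    rw [sub_eq_iff_eq_add] at hq
    obtain ⟨t, ht⟩ := X_dvd_sub_C (p := q)
    rw [sub_eq_iff_eq_add] at ht
    have hc : (C (q.coeff 0) : R[X]) = (k : R[X]) * C c := by
      rw [← Polynomial.C_eq_natCast, ← C_mul, ← mul_assoc, hv, one_mul]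
    rw [hs, hq]
    simp only [one_pow, mul_one]
    generalize hkc : (k : R[X]) * C c = e at *
    rw [hc] at ht
    refine ⟨t + e - X ^ M * q * e + (X ^ (M + 1) * q + (1 - X)) * s * C c ^ 2 * X ^ M, ?_⟩
    have h2 : (k : R[X]) * -(C c * X ^ (M + 1)) = - e * X ^ (M + 1) := by rw [← hkc]; ring
    rw [h2]
    have : q = X * t + e := ht
    rw [this]
    ring

end Root

/-! ### The class of `1 - N ⊗ cyclic`. -/

section Cyclic

variable {B : Type*} [CommRing B] {ι κ : Type*} [Fintype ι] [DecidableEq ι] [Fintype κ]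
  [DecidableEq κ]

theorem exists_coe_eq_one_sub_mul {X : Matrix ι κ B} {Y : Matrix κ ι B} (h : Y * X = 0) :
    ∃ u : GL ι B, (u : Matrix ι ι B) = 1 - X * Y ∧ cls u = 1 := by
  have h2 : X * Y * (X * Y) = 0 := by
    rw [Matrix.mul_assoc, ← Matrix.mul_assoc Y, h, Matrix.zero_mul, Matrix.mul_zero]
  let u : GL ι B :=
    { val := 1 - X * Y
      inv := 1 + X * Y
      val_inv := by rw [sub_mul, one_mul, mul_add, mul_one, h2]; abel
      inv_val := by rw [add_mul, one_mul, mul_sub, mul_one, h2]; abel }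
  exact ⟨u, rfl, cls_eq_one_of_mul_eq_zero rfl h⟩

/-- The lower shift matrix, with ones just below the diagonal in the columns before `j`. -/
def shift (B : Type*) [CommRing B] (m j : ℕ) : Matrix (Fin m) (Fin m) B :=
  Matrix.of fun a b => if (a : ℕ) = b + 1 ∧ (b : ℕ) < j then 1 else 0

/-- The shift is built one column at a time. A new entry is a rank-one `c * r` with `r * c = 0`, so
its factor has trivial class; the cross term vanishes because `shift B m j * c = 0`. -/
theorem exists_coe_eq_one_sub_kronecker_shift (N : Matrix ι ι B) (m j : ℕ) :
    ∃ u : GL (ι × Fin m) B,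
      (u : Matrix (ι × Fin m) (ι × Fin m) B) = 1 - N ⊗ₖ shift B m j ∧ cls u = 1 := by
  induction j with
  | zero =>
    refine ⟨1, ?_, map_one _⟩
    have : shift B m 0 = 0 := by ext; simp [shift]
    simp [this]
  | succ j ih =>
    obtain ⟨u, hu, hu'⟩ := ih
    let c : Matrix (Fin m) Unit B := Matrix.of fun a _ => if (a : ℕ) = j + 1 then 1 else 0
    let r : Matrix Unit (Fin m) B := Matrix.of fun _ b => if (b : ℕ) = j then 1 else 0
    have hrc : r * c = 0 := by
      ext
      rw [Matrix.mul_apply]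
      refine Finset.sum_eq_zero fun x _ => ?_
      by_cases h : (x : ℕ) = j <;> simp [r, c, h]
    have hsc : shift B m j * c = 0 := by
      ext
      rw [Matrix.mul_apply]
      refine Finset.sum_eq_zero fun x _ => ?_
      by_cases h : (x : ℕ) = j + 1 <;> simp [shift, c, h]
    have hs : shift B m (j + 1) = shift B m j + c * r := by
      ext a b
      simp only [shift, Matrix.add_apply, Matrix.of_apply, Matrix.mul_apply, c, r,
        Finset.univ_unique, Finset.sum_singleton, mul_ite, mul_one, mul_zero]
      split_ifs <;> first | omega | simp
    obtain ⟨v, hv, hv'⟩ := exists_coe_eq_one_sub_mul (X := N ⊗ₖ c) (Y := (1 : Matrix ι ι B) ⊗ₖ r)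
      (by rw [← Matrix.mul_kronecker_mul, hrc, Matrix.kronecker_zero])
    refine ⟨u * v, ?_, by rw [map_mul, hu', hv', one_mul]⟩
    rw [← Matrix.mul_kronecker_mul, Matrix.mul_one] at hv
    rw [Units.val_mul, hu, hv, sub_mul, one_mul, mul_sub, mul_one, ← Matrix.mul_kronecker_mul,
      ← Matrix.mul_assoc, hsc, Matrix.zero_mul, Matrix.kronecker_zero, hs, Matrix.kronecker_add]
    abel

/-- The weighted cyclic shift matrix: the matrix of multiplication by `t` on `B[t]/(tᵐ⁺¹ - y)`. -/
def cyclic (m : ℕ) (y : B) : Matrix (Fin (m + 1)) (Fin (m + 1)) B :=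
  shift B (m + 1) m + Matrix.single 0 (Fin.last m) y

theorem cls_eq_of_coe_eq_one_sub_kronecker_cyclic {m : ℕ} {y : B} {N : Matrix ι ι B}
    {u : GL (ι × Fin (m + 1)) B} {v : GL ι B}
    (hu : (u : Matrix (ι × Fin (m + 1)) (ι × Fin (m + 1)) B) = 1 - N ⊗ₖ cyclic m y)
    (hv : (v : Matrix ι ι B) = 1 - y • N ^ (m + 1)) : cls u = cls v := by
  obtain ⟨w, hw, hw'⟩ := exists_coe_eq_one_sub_kronecker_shift N (m + 1) m
  -- `U` is the first block column of the inverse of `w = 1 - N ⊗ shift`. Hence `w U W` is the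
  -- corner term of `N ⊗ cyclic`, so `w⁻¹ u = 1 - U W`, whereas `W U = y N^(m+1)`.
  let U : Matrix (ι × Fin (m + 1)) ι B := Matrix.of fun a b => (N ^ (a.2 : ℕ)) a.1 b
  let W : Matrix ι (ι × Fin (m + 1)) B :=
    Matrix.of fun a b => if b.2 = Fin.last m then y * N a b.1 else 0
  have hU : (1 - N ⊗ₖ shift B (m + 1) m) * U =
      Matrix.of fun a b => if a.2 = 0 then (1 : Matrix ι ι B) a.1 b else 0 := by
    rw [Matrix.sub_mul, Matrix.one_mul]
    ext ⟨a, i⟩ b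
    rw [Matrix.sub_apply, Matrix.mul_apply, Fintype.sum_prod_type_right]
    have h : ∀ j : Fin (m + 1), ∑ a', (N ⊗ₖ shift B (m + 1) m) (a, i) (a', j) * U (a', j) b =
        if (i : ℕ) = j + 1 then (N ^ (i : ℕ)) a b else 0 := by
      intro j
      by_cases hi : (i : ℕ) = j + 1
      · have : (j : ℕ) < m := by omega
        simp [shift, hi, this, U, pow_succ', Matrix.mul_apply]
      · simp [shift, hi]
    simp only [h]
    induction i using Fin.cases with
    | zero => simp [U]
    | succ i =>
      rw [Finset.sum_eq_single i.castSucc]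
      · simp [U]
      · intro j _ hj
        rw [if_neg]
        intro h
        apply hj
        ext
        simpa using h.symm
      · simp
  have hUW : (1 - N ⊗ₖ shift B (m + 1) m) * U * W = N ⊗ₖ Matrix.single 0 (Fin.last m) y := by
    rw [hU]
    ext ⟨a, i⟩ ⟨b, j⟩
    rw [Matrix.mul_apply]
    by_cases hi : i = 0 <;> by_cases hj : j = Fin.last m <;>
      simp [W, hi, hj, Matrix.one_apply, @eq_comm _ 0 i,
        @eq_comm _ (Fin.last m) j, mul_comm]
  have hWU : W * U = y • N ^ (m + 1) := by
    ext a b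
    rw [Matrix.mul_apply, Fintype.sum_prod_type_right, Finset.sum_eq_single (Fin.last m)]
    · simp [W, U, pow_succ', Matrix.mul_apply, Finset.mul_sum, mul_assoc]
    · intro j _ hj
      simp [W, hj]
    · simp
  have key : ((w⁻¹ * u : GL (ι × Fin (m + 1)) B) :
      Matrix (ι × Fin (m + 1)) (ι × Fin (m + 1)) B) = 1 - U * W := by
    rw [Units.val_mul, Units.inv_mul_eq_iff_eq_mul, mul_sub, mul_one, hw, ← Matrix.mul_assoc, hUW,
      hu, cyclic, Matrix.kronecker_add]
    abel
  have := cls_eq_of_one_sub_mul key (v := v) (by rw [hv, hWU])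
  rwa [map_mul, map_inv, hw', inv_one, one_mul] at this

end Cyclic

/-! ### Absence of k-torsion. -/

section Torsion

variable {R : Type*} [CommRing R] {κ : Type*} [Fintype κ] [DecidableEq κ]

/-- If `[1 - X N]` is `k`-torsion in `K₁(R[X])`, then so is `[1 - r Xᵐ⁺¹ Nᵐ⁺¹]`. -/
theorem cls_one_sub_pow_pow_eq_one {N : Matrix κ κ R} {k m : ℕ} {r : R} {u v : GL κ R[X]}
    (hu : (u : Matrix κ κ R[X]) = 1 - (X : R[X]) • N.map C) (huk : cls u ^ k = 1)
    (hv : (v : Matrix κ κ R[X]) = 1 - (C r * X ^ (m + 1)) • N.map C ^ (m + 1)) :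
    cls v ^ k = 1 := by
  let ρ : R[X] →ₐ[R] Matrix (Fin (m + 1)) (Fin (m + 1)) R[X] :=
    aeval (cyclic m (C r * X ^ (m + 1)))
  have h : cls (transfer (ρ : R[X] →+* Matrix (Fin (m + 1)) (Fin (m + 1)) R[X]) u) = cls v := by
    refine cls_eq_of_coe_eq_one_sub_kronecker_cyclic ?_ hv
    ext1 ⟨a, i⟩ ⟨b, j⟩
    have h1 : ρ (((u : Matrix κ κ R[X]) a b)) =
        (if a = b then 1 else 0) - N a b • cyclic m (C r * X ^ (m + 1)) := by
      rw [hu, Matrix.sub_apply, Matrix.smul_apply, Matrix.map_apply, smul_eq_mul, mul_comm,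
        ← Polynomial.smul_eq_C_mul, map_sub, map_smul, Matrix.one_apply, apply_ite ρ, map_one,
        map_zero]
      simp [ρ]
    rw [coe_transfer_apply]
    change ρ (((u : Matrix κ κ R[X]) a b)) i j = _
    rw [h1]
    by_cases h : a = b <;> simp [h, Matrix.one_apply, Polynomial.smul_eq_C_mul]
  rw [← h, ← map_pow, ← map_pow]
  rw [← map_pow] at huk
  exact cls_transfer_eq_one _ huk

theorem cls_eq_one_of_pow_eq_one {N : Matrix κ κ R} (hN : IsNilpotent N) {k : ℕ}
    (hk : IsUnit (k : R)) {u : GL κ R[X]}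
    (hu : (u : Matrix κ κ R[X]) = 1 - (X : R[X]) • N.map C) (huk : cls u ^ k = 1) :
    cls u = 1 := by
  obtain ⟨M, hM⟩ := hN
  have hM' : N.map (C : R → R[X]) ^ M = 0 := by
    have := congrArg (C : R →+* R[X]).mapMatrix hM
    rwa [map_pow, map_zero] at this
  obtain ⟨r, q, hq⟩ := exists_prod_pow_sub_dvd hk M
  -- This substitution kills `X ^ (M + 1)`, so the congruence for `1 - X` becomes an equality of
  -- matrices.
  let φ : R[X] →ₐ[R] Matrix κ κ R[X] := aeval ((X : R[X]) • N.map C)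
  have hφX : φ X = (X : R[X]) • N.map C := aeval_X _
  have hφ : ∀ m, φ (1 - C (r m) * X ^ (m + 1)) =
      1 - (C (r m) * X ^ (m + 1)) • N.map C ^ (m + 1) := fun m => by
    rw [← Polynomial.smul_eq_C_mul, map_sub, map_one, map_smul, map_pow, hφX, _root_.smul_pow,
      smul_assoc]
  have hφM : φ (X ^ (M + 1)) = 0 := by
    rw [map_pow, hφX, _root_.smul_pow, pow_succ (N.map C), hM', zero_mul, smul_zero]
  have hprod : ∀ j, ∃ V : GL κ R[X], (V : Matrix κ κ R[X]) =
      φ (∏ m ∈ Finset.range j, (1 - C (r m) * X ^ (m + 1))) ∧ cls V ^ k = 1 := by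
    intro j
    induction j with
    | zero => exact ⟨1, by simp, by simp⟩
    | succ j ih =>
      obtain ⟨V, hV, hV'⟩ := ih
      have hnil : IsNilpotent ((C (r j) * X ^ (j + 1) : R[X]) • N.map C ^ (j + 1)) := by
        refine ⟨M, ?_⟩
        rw [_root_.smul_pow, pow_right_comm (N.map C), hM', zero_pow j.succ_ne_zero, smul_zero]
      obtain ⟨v, hv⟩ := hnil.isUnit_one_sub
      refine ⟨V * v, ?_, ?_⟩
      · rw [Finset.prod_range_succ, map_mul, hφ, Units.val_mul, hV, hv]
      · rw [map_mul, mul_pow, hV', cls_one_sub_pow_pow_eq_one hu huk hv, one_mul]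
  obtain ⟨V, hV, hV'⟩ := hprod M
  have : V ^ k = u := by
    apply Units.ext
    rw [Units.val_pow_eq_pow_val, hV, ← map_pow, sub_eq_iff_eq_add.1 hq, map_add, map_mul, hφM,
      zero_mul, zero_add, map_sub, map_one, hφX, hu]
  rw [← this, map_pow, hV']

theorem cls_eq_one_of_det_eq_one_of_pow_eq_one [IsLocalRing R] {k : ℕ} (hk : IsUnit (k : R))
    {n : ℕ} {g : GL (Fin n) R[X]} (hg : Matrix.GeneralLinearGroup.det g = 1)
    (hgk : cls g ^ k = 1) : cls g = 1 := by
  -- The constant part `g(0)` has determinant 1 over the local ring `R`; dividing by it gives the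
  -- constant term 1 that linearization needs.
  let g₀ : GL (Fin n) R := Matrix.GeneralLinearGroup.map (evalRingHom 0) g
  have h₀ : cls g₀ = 1 := by
    apply cls_eq_one_of_det_eq_one
    rw [Matrix.GeneralLinearGroup.map_det, hg, map_one]
  let c : GL (Fin n) R[X] := Matrix.GeneralLinearGroup.map C g₀
  have hc : cls c = 1 := cls_map_eq_one C h₀
  have h1 : Matrix.GeneralLinearGroup.map (evalRingHom 0) (g * c⁻¹) = 1 := by
    rw [map_mul, map_inv, mul_inv_eq_one]
    apply Units.ext
    ext a b
    simp [c, g₀]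
  have h2 : cls (g * c⁻¹) = cls g := by simp [hc]
  obtain ⟨κ, _, _, N, u, hu, hug⟩ := exists_cls_eq_linear
    (Finset.univ.sup fun ab : Fin n × Fin n =>
      (((g * c⁻¹ : GL (Fin n) R[X]) : Matrix (Fin n) (Fin n) R[X]) ab.1 ab.2).natDegree)
    (g * c⁻¹)
    (fun a b => (Finset.le_sup (f := fun ab : Fin n × Fin n =>
      (((g * c⁻¹ : GL (Fin n) R[X]) : Matrix (Fin n) (Fin n) R[X]) ab.1 ab.2).natDegree)
      (Finset.mem_univ (a, b))).trans (Nat.le_succ _))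
    (fun a b => by
      rw [coeff_zero_eq_eval_zero]
      exact congrArg (fun h : GL (Fin n) R => (h : Matrix (Fin n) (Fin n) R) a b) h1)
  rw [h2] at hug
  rw [← hug] at hgk ⊢
  exact cls_eq_one_of_pow_eq_one
    (isNilpotent_of_isUnit_one_sub_X_smul (hu ▸ u.isUnit)) hk hu hgk

end Torsion

end KOne

theorem mainTheorem2 {R : Type*} [CommRing R] [IsLocalRing R] (k : ℕ) (hk : IsUnit (k : R))
    (x : KOne.SK1 (Polynomial R)) (hx : x ^ k = 1) : x = 1 := by
  obtain ⟨x, hx'⟩ := x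
  obtain ⟨y, rfl⟩ := QuotientGroup.mk_surjective x
  obtain ⟨n, g, rfl⟩ := KOne.exists_toStable_eq y
  have hg : ((KOne.toStable (Polynomial R) n g : KOne.StableGL (Polynomial R)) :
    KOne.K1 (Polynomial R)) = KOne.cls g := (KOne.cls_eq_finCls g).symm
  ext1
  have h : KOne.cls g ^ k = 1 := by
    rw [← hg]
    exact congrArg Subtype.val hx
  exact hg.trans (KOne.cls_eq_one_of_det_eq_one_of_pow_eq_one hk
    (by rw [← KOne.det_cls, ← hg]; exact hx') h)
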